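/- Let $f\colon[0,1)\to[0,1)$, $f(x)=\frac{1}{1-x}-\left\lfloor\frac{1}{1-x}\right\rfloor$, be the Rényi map, and for $x\in[0,1)$ and $j\ge1$ let $$b_j(x)=\left\lfloor\frac{1}{1-f^{j-1}(x)}\right\rfloor+1 .$$ For irrational $x\in(0,1)$ these integers $b_j(x)\ge 2$ are the digits of the backward continued fraction (BCF) expansion $$x=1-\cfrac{1}{b_1(x)-\cfrac{1}{b_2(x)-\cfrac{1}{\ddots}}}.$$ For each integer $n\ge 2$ let $E(n)=\{x\in[0,1)\colon b_j(x)\le n\ \text{ for all } j\ge1\}$. Then $$\lim_{n\to\infty}\dim_H E(n)=1,$$ where $\dim_H$ denotes Hausdorff dimension. Moreover, the set of irrational numbers in $(0,1)$ whose BCF digits are bounded has Hausdorff dimension $1$. -/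

import Mathlib

open Filter Topology

/-- The Rényi map `x ↦ 1/(1-x) - ⌊1/(1-x)⌋`, used on `[0,1)`, which it maps to itself. -/
noncomputable def renyiMap (x : ℝ) : ℝ :=
  1 / (1 - x) - (⌊1 / (1 - x)⌋ : ℝ)

/-- The `j`-th digit (`j ≥ 1`) of the backward continued fraction expansion of `x ∈ [0,1)`,
`b_j(x) = ⌊1 / (1 - f^(j-1) x)⌋ + 1` with `f` the Rényi map. -/
noncomputable def bcfDigit (j : ℕ) (x : ℝ) : ℤ :=
  ⌊1 / (1 - renyiMap^[j - 1] x)⌋ + 1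

/-- The set `E(n)` of all `x ∈ [0,1)` whose digits `b_1(x), b_2(x), …` are all at most `n`. -/
def bcfBoundedBy (n : ℕ) : Set ℝ :=
  {x | x ∈ Set.Ico (0 : ℝ) 1 ∧ ∀ j : ℕ, 1 ≤ j → bcfDigit j x ≤ (n : ℤ)}

/-- The set of irrational numbers in `(0,1)` with bounded backward continued fraction digits. -/
def bcfBounded : Set ℝ :=
  {x | x ∈ Set.Ioo (0 : ℝ) 1 ∧ Irrational x ∧
    ∃ n : ℕ, ∀ j : ℕ, 1 ≤ j → bcfDigit j x ≤ (n : ℤ)}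

open scoped ENNReal NNReal

/-! The Rényi map has a neutral fixed point at 0, so its inverse branches do not contract uniformly.
Inducing on `[1/2, 1)` cures this: the inverse branches of the first return map contract by at least
1/4, and their compositions are Möbius maps of determinant one with distortion at most 4.

The images of words of length `m` cover the irrationals of `[1/2, 1]`, so their contraction ratios
`c` sum to at least 1/4 (`one_fourth_le_tsum_wordRatio`). Since `c ≤ 4^(-m)`, for `s < 1` the sum of
`c^s` is at least `4^(m(1-s)) / 4`, which exceeds 1 for large `m`, already over a finite set of
words (`exists_one_le_sum_wordRatio_rpow`).

These finitely many words generate a compact invariant set whose digits are bounded. Its dimension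
is at least `s` by a covering argument needing no measure on the set (`le_dimH_of_sum_rpow_ge_one`).
-/

/-! ### Dimension lower bound from separated expanding copies -/

theorem edist_pos_of_pairwise_disjoint_compact {X ι : Type*} [MetricSpace X]
    (W : Finset ι) (K : ι → Set X) (hK : ∀ w ∈ W, IsCompact (K w))
    (hd : ∀ v ∈ W, ∀ w ∈ W, v ≠ w → Disjoint (K v) (K w)) :
    ∃ δ : ℝ≥0, 0 < δ ∧ ∀ v ∈ W, ∀ w ∈ W, v ≠ w → ∀ x ∈ K v, ∀ y ∈ K w, (δ : ℝ≥0∞) ≤ edist x y := by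
  classical
  have key : ∀ P : Finset (ι × ι), (∀ q ∈ P, q.1 ∈ W ∧ q.2 ∈ W ∧ q.1 ≠ q.2) →
      ∃ δ : ℝ≥0, 0 < δ ∧ ∀ q ∈ P, ∀ x ∈ K q.1, ∀ y ∈ K q.2, (δ : ℝ≥0∞) ≤ edist x y := by
    intro P
    induction P using Finset.induction_on with
    | empty => exact fun _ => ⟨1, one_pos, by simp⟩
    | insert q P _ ih =>
      intro h
      obtain ⟨δ, hδ, H⟩ := ih fun q hq => h q (Finset.mem_insert_of_mem hq)
      obtain ⟨h1, h2, h3⟩ := h q (Finset.mem_insert_self _ _)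
      obtain ⟨r, hr, H'⟩ := Metric.exists_pos_forall_lt_edist (hK _ h1) (hK _ h2).isClosed
        (hd _ h1 _ h2 h3)
      refine ⟨min δ r, lt_min hδ hr, fun p hp x hx y hy => ?_⟩
      rcases Finset.mem_insert.1 hp with rfl | hp
      · exact (ENNReal.coe_le_coe.2 (min_le_right _ _)).trans (H' x hx y hy).le
      · exact (ENNReal.coe_le_coe.2 (min_le_left _ _)).trans (H p hp x hx y hy)
  obtain ⟨δ, hδ, H⟩ := key ((W ×ˢ W).filter fun q => q.1 ≠ q.2) (by
    intro q hq
    simpa [and_assoc] using hq)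
  refine ⟨δ, hδ, fun v hv w hw hvw => H (v, w) ?_⟩
  simp [hv, hw, hvw]

/-- Induction on the size of the cover. If every `U i` has diameter below the gap `δ`, each meets at
most one copy `φ w '' E`, so the cover splits into disjoint subcovers. Pulling one back by `φ w`
gives a smaller cover of `E`, with diameters enlarged by at most `1 / c w`; the bounds add up by
`hsum`. -/
theorem le_sum_ediam_rpow_of_finite_cover {X ι : Type*} [MetricSpace X] {E : Set X}
    (hne : E.Nonempty) (W : Finset ι) (hW : W.Nontrivial) (φ : ι → X → X) (c : ι → ℝ≥0) {s : ℝ≥0}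
    (hc : ∀ w ∈ W, 0 < c w) (hsum : 1 ≤ ∑ w ∈ W, (c w : ℝ≥0∞) ^ (s : ℝ))
    (hmaps : ∀ w ∈ W, ∀ x ∈ E, φ w x ∈ E)
    (hanti : ∀ w ∈ W, ∀ x ∈ E, ∀ y ∈ E, c w * edist x y ≤ edist (φ w x) (φ w y))
    {δ : ℝ≥0} (hδ : ∀ v ∈ W, ∀ w ∈ W, v ≠ w → ∀ x ∈ φ v '' E, ∀ y ∈ φ w '' E,
      (δ : ℝ≥0∞) ≤ edist x y) :
    ∀ (I : Finset ℕ) (U : ℕ → Set X), E ⊆ ⋃ i ∈ I, U i →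
      (δ : ℝ≥0∞) ^ (s : ℝ) ≤ ∑ i ∈ I, Metric.ediam (U i) ^ (s : ℝ) := by
  classical
  intro I
  induction I using Finset.strongInduction with
  | H I ih =>
  intro U hU
  by_cases hbig : ∃ i ∈ I, (δ : ℝ≥0∞) ≤ Metric.ediam (U i)
  · obtain ⟨i, hi, hi'⟩ := hbig
    exact (ENNReal.rpow_le_rpow hi' s.2).trans
      (Finset.single_le_sum (f := fun i => Metric.ediam (U i) ^ (s : ℝ))
        (fun _ _ => zero_le) hi)
  push Not at hbig
  let J : ι → Finset ℕ := fun w => I.filter fun i => (U i ∩ φ w '' E).Nonempty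
  have hJd : ∀ v ∈ W, ∀ w ∈ W, v ≠ w → Disjoint (J v) (J w) := by
    intro v hv w hw hvw
    rw [Finset.disjoint_left]
    intro i hiv hiw
    obtain ⟨hi, x, hxU, hx⟩ := Finset.mem_filter.1 hiv
    obtain ⟨-, y, hyU, hy⟩ := Finset.mem_filter.1 hiw
    exact absurd ((hδ v hv w hw hvw x hx y hy).trans (Metric.edist_le_ediam_of_mem hxU hyU))
      (not_le.2 (hbig i hi))
  have hJcov : ∀ w ∈ W, ∀ x ∈ E, ∃ i ∈ J w, φ w x ∈ U i := by
    intro w hw x hx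
    obtain ⟨i, hi, hxi⟩ := Set.mem_iUnion₂.1 (hU (hmaps w hw x hx))
    exact ⟨i, Finset.mem_filter.2 ⟨hi, φ w x, hxi, x, hx, rfl⟩, hxi⟩
  -- Another word `v` needs a cover element too, and `J w` cannot contain it.
  have hJlt : ∀ w ∈ W, J w ⊂ I := by
    intro w hw
    refine (Finset.filter_subset _ _).ssubset_of_ne fun h => ?_
    obtain ⟨v, hv, hvw⟩ := hW.exists_ne w
    obtain ⟨x, hx⟩ := hne
    obtain ⟨i, hi, -⟩ := hJcov v hv x hx
    exact Finset.disjoint_left.1 (hJd v hv w hw hvw) hi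
      (by rw [show J w = I from h]; exact (Finset.mem_filter.1 hi).1)
  have step : ∀ w ∈ W, (c w : ℝ≥0∞) ^ (s : ℝ) * (δ : ℝ≥0∞) ^ (s : ℝ) ≤
      ∑ i ∈ J w, Metric.ediam (U i) ^ (s : ℝ) := by
    intro w hw
    have h1 := ih (J w) (hJlt w hw) (fun i => φ w ⁻¹' U i ∩ E) (by
      intro x hx
      obtain ⟨i, hi, hxi⟩ := hJcov w hw x hx
      exact Set.mem_iUnion₂.2 ⟨i, hi, hxi, hx⟩)
    calc _ ≤ (c w : ℝ≥0∞) ^ (s : ℝ) * ∑ i ∈ J w, Metric.ediam (φ w ⁻¹' U i ∩ E) ^ (s : ℝ) := by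
          gcongr
      _ = ∑ i ∈ J w, ((c w : ℝ≥0∞) * Metric.ediam (φ w ⁻¹' U i ∩ E)) ^ (s : ℝ) := by
          rw [Finset.mul_sum]
          exact Finset.sum_congr rfl fun i _ => (ENNReal.mul_rpow_of_nonneg _ _ s.2).symm
      _ ≤ _ := by
          refine Finset.sum_le_sum fun i _ => ENNReal.rpow_le_rpow ?_ s.2
          have hc0 : (c w : ℝ≥0∞) ≠ 0 := by simpa using (hc w hw).ne'
          rw [mul_comm, ← ENNReal.le_div_iff_mul_le (Or.inl hc0) (Or.inl ENNReal.coe_ne_top)]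
          refine Metric.ediam_le fun x hx y hy => ?_
          rw [ENNReal.le_div_iff_mul_le (Or.inl hc0) (Or.inl ENNReal.coe_ne_top), mul_comm]
          exact (hanti w hw x hx.2 y hy.2).trans (Metric.edist_le_ediam_of_mem hx.1 hy.1)
  calc (δ : ℝ≥0∞) ^ (s : ℝ) ≤ (∑ w ∈ W, (c w : ℝ≥0∞) ^ (s : ℝ)) * (δ : ℝ≥0∞) ^ (s : ℝ) :=
        le_mul_of_one_le_left zero_le hsum
    _ = ∑ w ∈ W, (c w : ℝ≥0∞) ^ (s : ℝ) * (δ : ℝ≥0∞) ^ (s : ℝ) := Finset.sum_mul _ _ _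
    _ ≤ ∑ w ∈ W, ∑ i ∈ J w, Metric.ediam (U i) ^ (s : ℝ) := Finset.sum_le_sum step
    _ = ∑ i ∈ W.biUnion J, Metric.ediam (U i) ^ (s : ℝ) := by
        rw [Finset.sum_biUnion]
        exact fun v hv w hw h => hJd v hv w hw h
    _ ≤ _ := Finset.sum_le_sum_of_subset
        (Finset.biUnion_subset.2 fun w _ => Finset.filter_subset _ _)

/-- Lets a countable cover by arbitrary sets be made open at small cost, so that compactness
applies. The supremum over `t.Nonempty` matches the summand in `hausdorffMeasure_apply`. -/
theorem exists_isOpen_superset_ediam_rpow_le {X : Type*} [MetricSpace X] (t : Set X)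
    (ht : Metric.ediam t ≠ ∞) {s : ℝ} (hs : 0 < s) {ε : ℝ≥0∞} (hε : 0 < ε) :
    ∃ V : Set X, IsOpen V ∧ t ⊆ V ∧
      Metric.ediam V ^ s ≤ (⨆ _ : t.Nonempty, Metric.ediam t ^ s) + ε := by
  rcases t.eq_empty_or_nonempty with rfl | hne
  · exact ⟨∅, isOpen_empty, subset_rfl, by simp [hs]⟩
  have hcont : Tendsto (fun η : ℝ≥0 => (Metric.ediam t + 2 * (η : ℝ≥0∞)) ^ s) (𝓝[>] 0)
      (𝓝 (Metric.ediam t ^ s)) := by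
    have : Continuous fun η : ℝ≥0 => (Metric.ediam t + 2 * (η : ℝ≥0∞)) ^ s :=
      ENNReal.continuous_rpow_const.comp (continuous_const.add
        ((ENNReal.continuous_const_mul (by simp)).comp ENNReal.continuous_coe))
    simpa using (this.tendsto 0).mono_left nhdsWithin_le_nhds
  have hlt : Metric.ediam t ^ s < Metric.ediam t ^ s + ε :=
    ENNReal.lt_add_right (ENNReal.rpow_ne_top_of_nonneg hs.le ht) hε.ne'
  obtain ⟨η, hη, hη0⟩ := ((hcont.eventually (gt_mem_nhds hlt)).and self_mem_nhdsWithin).exists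
  have hη0' : 0 < η := hη0
  refine ⟨Metric.thickening η t, Metric.isOpen_thickening,
    Metric.self_subset_thickening (by exact_mod_cast hη0') t, ?_⟩
  rw [ciSup_pos hne]
  exact (ENNReal.rpow_le_rpow (Metric.ediam_thickening_le η) hs.le).trans hη.le

theorem le_dimH_of_sum_rpow_ge_one {X ι : Type*} [MetricSpace X] {E : Set X} (hE : IsCompact E)
    (hne : E.Nonempty) (W : Finset ι) (φ : ι → X → X) (c : ι → ℝ≥0) {s : ℝ≥0} (hs : 0 < s)
    (hc : ∀ w ∈ W, 0 < c w) (hc1 : ∀ w ∈ W, c w < 1)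
    (hsum : 1 ≤ ∑ w ∈ W, (c w : ℝ≥0∞) ^ (s : ℝ))
    (hcont : ∀ w ∈ W, ContinuousOn (φ w) E) (hmaps : ∀ w ∈ W, ∀ x ∈ E, φ w x ∈ E)
    (hanti : ∀ w ∈ W, ∀ x ∈ E, ∀ y ∈ E, c w * edist x y ≤ edist (φ w x) (φ w y))
    (hd : ∀ v ∈ W, ∀ w ∈ W, v ≠ w → Disjoint (φ v '' E) (φ w '' E)) :
    (s : ℝ≥0∞) ≤ dimH E := by
  borelize X
  have hs' : (0 : ℝ) < s := hs
  have hW : W.Nontrivial := by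
    by_contra h
    rcases (Set.not_nontrivial_iff.1 h).eq_empty_or_singleton with h | ⟨w, h⟩
    · have : W = ∅ := by exact_mod_cast h
      simp [this] at hsum
    · have h : W = {w} := by exact_mod_cast h
      rw [h, Finset.sum_singleton] at hsum
      exact absurd hsum (not_le.2 (ENNReal.rpow_lt_one
        (by exact_mod_cast hc1 w (h ▸ Finset.mem_singleton_self w)) hs'))
  obtain ⟨δ, hδ0, hδ⟩ := edist_pos_of_pairwise_disjoint_compact W (fun w => φ w '' E)
    (fun w hw => hE.image_of_continuousOn (hcont w hw)) hd
  have hfin := le_sum_ediam_rpow_of_finite_cover hne W hW φ c hc hsum hmaps hanti hδ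
  refine le_dimH_of_hausdorffMeasure_ne_zero (ne_of_gt ?_)
  have hδs : (0 : ℝ≥0∞) < (δ : ℝ≥0∞) ^ (s : ℝ) :=
    ENNReal.rpow_pos (by exact_mod_cast hδ0) ENNReal.coe_ne_top
  refine hδs.trans_le ?_
  rw [MeasureTheory.Measure.hausdorffMeasure_apply]
  -- The bound holds for covers of any mesh; mesh 1 is used only to keep diameters finite.
  refine le_trans ?_ (le_iSup₂ (1 : ℝ≥0∞) one_pos)
  refine le_iInf fun t => le_iInf fun ht => le_iInf fun htd => ?_
  refine ENNReal.le_of_forall_pos_le_add fun ε hε _ => ?_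
  obtain ⟨ε', hε', hε'sum⟩ := ENNReal.exists_pos_sum_of_countable
    (ε := (ε : ℝ≥0∞)) (by exact_mod_cast hε.ne') ℕ
  choose V hVo htV hV using fun n => exists_isOpen_superset_ediam_rpow_le (t n)
    ((htd n).trans_lt ENNReal.one_lt_top).ne hs' (ENNReal.coe_pos.2 (hε' n))
  obtain ⟨I, hI⟩ := hE.elim_finite_subcover V hVo
    (ht.trans (Set.iUnion_mono htV))
  calc (δ : ℝ≥0∞) ^ (s : ℝ) ≤ ∑ i ∈ I, Metric.ediam (V i) ^ (s : ℝ) := hfin I V hI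
    _ ≤ ∑' i, Metric.ediam (V i) ^ (s : ℝ) := ENNReal.sum_le_tsum I
    _ ≤ ∑' i, ((⨆ _ : (t i).Nonempty, Metric.ediam (t i) ^ (s : ℝ)) + ε' i) :=
        ENNReal.tsum_le_tsum hV
    _ = _ := ENNReal.tsum_add
    _ ≤ _ := by gcongr

/-! ### The compact invariant set of a finite family of maps -/

/-- The largest set `A ⊆ J` that is covered by its own images. -/
def maximalSelfCover {X ι : Type*} (J : Set X) (W : Finset ι) (φ : ι → X → X) : Set X :=
  ⋃₀ {A | A ⊆ J ∧ A ⊆ ⋃ w ∈ W, φ w '' A}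

section
variable {X ι : Type*} {J : Set X} {W : Finset ι} {φ : ι → X → X}

theorem maximalSelfCover_subset : maximalSelfCover J W φ ⊆ J :=
  Set.sUnion_subset fun _ h => h.1

theorem subset_maximalSelfCover {A : Set X} (h : A ⊆ J) (h' : A ⊆ ⋃ w ∈ W, φ w '' A) :
    A ⊆ maximalSelfCover J W φ :=
  Set.subset_sUnion_of_mem ⟨h, h'⟩

theorem maximalSelfCover_subset_iUnion_image :
    maximalSelfCover J W φ ⊆ ⋃ w ∈ W, φ w '' maximalSelfCover J W φ := by
  refine Set.sUnion_subset fun A hA => hA.2.trans ?_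
  exact Set.iUnion₂_mono fun w _ => Set.image_mono (subset_maximalSelfCover hA.1 hA.2)

theorem mapsTo_maximalSelfCover (hm : ∀ w ∈ W, Set.MapsTo (φ w) J J) {w : ι} (hw : w ∈ W) :
    Set.MapsTo (φ w) (maximalSelfCover J W φ) (maximalSelfCover J W φ) := by
  have h : (⋃ w ∈ W, φ w '' maximalSelfCover J W φ) ⊆ maximalSelfCover J W φ := by
    refine subset_maximalSelfCover ?_ ?_
    · exact Set.iUnion₂_subset fun w hw =>
        ((hm w hw).mono_left maximalSelfCover_subset).image_subset
    · exact Set.iUnion₂_mono fun w _ => Set.image_mono maximalSelfCover_subset_iUnion_image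
  exact fun x hx => h (Set.mem_iUnion₂.2 ⟨w, hw, x, hx, rfl⟩)

/-- The closure is again covered by its own images, so maximality makes the set closed. No
contraction is needed. -/
theorem isCompact_maximalSelfCover [TopologicalSpace X] [T2Space X] (hJ : IsCompact J)
    (hc : ∀ w ∈ W, ContinuousOn (φ w) J) : IsCompact (maximalSelfCover J W φ) := by
  have hcl : closure (maximalSelfCover J W φ) ⊆ J :=
    closure_minimal maximalSelfCover_subset hJ.isClosed
  have hcomp : IsCompact (closure (maximalSelfCover J W φ)) := hJ.of_isClosed_subset isClosed_closure hcl
  have : closure (maximalSelfCover J W φ) ⊆ maximalSelfCover J W φ := by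
    refine subset_maximalSelfCover hcl (closure_minimal
      (maximalSelfCover_subset_iUnion_image.trans
        (Set.iUnion₂_mono fun w _ => Set.image_mono subset_closure)) ?_)
    exact W.finite_toSet.isClosed_biUnion fun w hw =>
      (hcomp.image_of_continuousOn ((hc w hw).mono hcl)).isClosed
  rwa [(this.antisymm subset_closure)] at hcomp

end

/-! ### Inverse branches and digits -/

/-- The inverse branch of the Rényi map whose digit is `a + 1`. -/
noncomputable def renyiBranch (a : ℕ) (y : ℝ) : ℝ := 1 - 1 / (a + y)

theorem renyiBranch_mem_Ico {a : ℕ} (ha : 1 ≤ a) {y : ℝ} (hy : y ∈ Set.Ico (0 : ℝ) 1) :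
    renyiBranch a y ∈ Set.Ico (0 : ℝ) 1 := by
  have ha' : (1 : ℝ) ≤ a := by exact_mod_cast ha
  have hy0 := hy.1
  have h1 : 1 / ((a : ℝ) + y) ≤ 1 := by rw [div_le_one (by linarith)]; linarith
  have h2 : 0 < 1 / ((a : ℝ) + y) := by positivity
  constructor <;> unfold renyiBranch <;> linarith

theorem one_div_one_sub_renyiBranch (a : ℕ) (y : ℝ) : 1 / (1 - renyiBranch a y) = a + y := by
  simp [renyiBranch]

theorem floor_natCast_add_of_mem_Ico (a : ℕ) {y : ℝ} (hy : y ∈ Set.Ico (0 : ℝ) 1) :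
    ⌊(a : ℝ) + y⌋ = a := by
  rw [Int.floor_natCast_add, Int.floor_eq_zero_iff.2 hy, add_zero]

theorem renyiMap_renyiBranch (a : ℕ) {y : ℝ} (hy : y ∈ Set.Ico (0 : ℝ) 1) :
    renyiMap (renyiBranch a y) = y := by
  rw [renyiMap, one_div_one_sub_renyiBranch, floor_natCast_add_of_mem_Ico a hy]
  simp

/-- The points of `[0,1)` whose first `m` digits are at most `n`. -/
def bcfPrefixBoundedBy (n m : ℕ) : Set ℝ :=
  {x | x ∈ Set.Ico (0 : ℝ) 1 ∧ ∀ j < m, bcfDigit (j + 1) x ≤ (n : ℤ)}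

theorem renyiBranch_mem_bcfPrefixBoundedBy {n m a : ℕ} (ha : 1 ≤ a) (han : a < n) {y : ℝ}
    (hy : y ∈ bcfPrefixBoundedBy n m) : renyiBranch a y ∈ bcfPrefixBoundedBy n (m + 1) := by
  refine ⟨renyiBranch_mem_Ico ha hy.1, fun j hj => ?_⟩
  rcases j with _ | j
  · simp only [bcfDigit, zero_add, Nat.sub_self, Function.iterate_zero, id]
    rw [one_div_one_sub_renyiBranch, floor_natCast_add_of_mem_Ico a hy.1]
    exact_mod_cast han
  · have := hy.2 j (by omega)
    simp only [bcfDigit, Nat.add_sub_cancel, Function.iterate_succ_apply] at this ⊢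
    rwa [renyiMap_renyiBranch a hy.1]

theorem bcfPrefixBoundedBy_succ_subset (n m : ℕ) :
    bcfPrefixBoundedBy n (m + 1) ⊆ bcfPrefixBoundedBy n m :=
  fun _ hx => ⟨hx.1, fun j hj => hx.2 j (by omega)⟩

theorem mem_bcfBoundedBy_of_forall_prefix {n : ℕ} {x : ℝ} (h : ∀ m, x ∈ bcfPrefixBoundedBy n m) :
    x ∈ bcfBoundedBy n := by
  refine ⟨(h 0).1, fun j hj => ?_⟩
  obtain ⟨j, rfl⟩ := Nat.exists_eq_add_of_le' hj
  exact (h (j + 1)).2 j (by omega)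

/-! ### Return branches -/

/-- The inverse branches of the first return map of the Rényi map to `[1/2, 1)`. -/
noncomputable def returnBranch (i : ℕ × ℕ) (y : ℝ) : ℝ :=
  renyiBranch (i.1 + 2) ((renyiBranch 1)^[i.2] y)

theorem iterate_renyiBranch_one (k : ℕ) {y : ℝ} (hy : 0 ≤ y) :
    (renyiBranch 1)^[k] y = y / (1 + k * y) := by
  induction k with
  | zero => simp
  | succ k ih =>
    rw [Function.iterate_succ_apply', ih, renyiBranch]
    have : 0 < 1 + k * y := by positivity
    have : 0 < 1 + (k + 1 : ℕ) * y := by positivity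
    push_cast at *
    have h3 : (1 : ℝ) + y / (1 + k * y) = (1 + (k + 1) * y) / (1 + k * y) := by
      field_simp; ring
    rw [h3]
    field_simp
    ring

theorem iterate_renyiBranch_one_mem_Ico (k : ℕ) {y : ℝ} (hy : y ∈ Set.Ico (0 : ℝ) 1) :
    (renyiBranch 1)^[k] y ∈ Set.Ico (0 : ℝ) 1 := by
  induction k with
  | zero => simpa using hy
  | succ k ih =>
    rw [Function.iterate_succ_apply']
    exact renyiBranch_mem_Ico le_rfl ih

/-- The branch prepends the digit `i.1 + 3` and then `i.2` digits equal to 2, so only `i.1` has to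
be bounded. -/
theorem returnBranch_mem_bcfPrefixBoundedBy {n m : ℕ} {i : ℕ × ℕ} (hi : i.1 + 2 < n) {y : ℝ}
    (hy : y ∈ bcfPrefixBoundedBy n m) : returnBranch i y ∈ bcfPrefixBoundedBy n (m + 1) := by
  refine renyiBranch_mem_bcfPrefixBoundedBy (by omega) hi ?_
  generalize i.2 = k
  induction k with
  | zero => simpa using hy
  | succ k ih =>
    rw [Function.iterate_succ_apply']
    exact bcfPrefixBoundedBy_succ_subset _ _
      (renyiBranch_mem_bcfPrefixBoundedBy le_rfl (by omega) ih)

theorem returnBranch_eq_div (i : ℕ × ℕ) {y : ℝ} (hy : 0 ≤ y) :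
    returnBranch i y = ((1 + i.2 * (i.1 + 1)) * y + (i.1 + 1)) /
      ((1 + i.2 * (i.1 + 2)) * y + (i.1 + 2)) := by
  rw [returnBranch, iterate_renyiBranch_one _ hy, renyiBranch]
  have h1 : 0 < 1 + i.2 * y := by positivity
  have h2 : 0 < (1 + i.2 * (i.1 + 2)) * y + (i.1 + 2 : ℝ) := by positivity
  have h3 : ((i.1 + 2 : ℕ) : ℝ) + y / (1 + i.2 * y) =
      ((1 + i.2 * (i.1 + 2)) * y + (i.1 + 2)) / (1 + i.2 * y) := by
    push_cast
    field_simp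
    ring
  rw [h3]
  field_simp
  ring

/-! ### Möbius form and bounded distortion -/

/-- Möbius maps of determinant one with nonnegative coefficients that are finite at the origin. -/
def IsPositiveMobius (φ : ℝ → ℝ) : Prop :=
  ∃ p q r t : ℝ, 0 ≤ p ∧ 0 ≤ q ∧ 0 ≤ r ∧ 0 < t ∧ p * t - q * r = 1 ∧
    ∀ x, 0 ≤ x → φ x = (p * x + q) / (r * x + t)

theorem isPositiveMobius_id : IsPositiveMobius id :=
  ⟨1, 0, 0, 1, by simp⟩

theorem IsPositiveMobius.comp {φ ψ : ℝ → ℝ} (hφ : IsPositiveMobius φ) (hψ : IsPositiveMobius ψ) :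
    IsPositiveMobius (φ ∘ ψ) := by
  obtain ⟨p, q, r, t, hp, hq, hr, ht, hdet, h⟩ := hφ
  obtain ⟨p', q', r', t', hp', hq', hr', ht', hdet', h'⟩ := hψ
  refine ⟨p * p' + q * r', p * q' + q * t', r * p' + t * r', r * q' + t * t',
    by positivity, by positivity, by positivity, by positivity, ?_, fun x hx => ?_⟩
  · linear_combination (p' * t' - q' * r') * hdet + hdet'
  · have hd : 0 < r' * x + t' := by positivity
    have hn : 0 ≤ (p' * x + q') / (r' * x + t') := by positivity
    rw [Function.comp_apply, h' x hx, h _ hn]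
    have h1 : 0 < r * ((p' * x + q') / (r' * x + t')) + t := by positivity
    have h2 : 0 < (r * p' + t * r') * x + (r * q' + t * t') := by positivity
    rw [div_eq_div_iff h1.ne' h2.ne']
    field_simp
    ring

theorem isPositiveMobius_returnBranch (i : ℕ × ℕ) : IsPositiveMobius (returnBranch i) :=
  ⟨1 + i.2 * (i.1 + 1), i.1 + 1, 1 + i.2 * (i.1 + 2), i.1 + 2, by positivity, by positivity,
    by positivity, by positivity, by ring, fun _ hx => returnBranch_eq_div i hx⟩

theorem abs_div_sub_div_of_det_eq_one {p q r t x y : ℝ} (hr : 0 ≤ r) (ht : 0 < t)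
    (hdet : p * t - q * r = 1) (hx : 0 ≤ x) (hy : 0 ≤ y) :
    |(p * x + q) / (r * x + t) - (p * y + q) / (r * y + t)| =
      |x - y| / ((r * x + t) * (r * y + t)) := by
  have h1 : 0 < r * x + t := by positivity
  have h2 : 0 < r * y + t := by positivity
  rw [div_sub_div _ _ h1.ne' h2.ne', abs_div, abs_of_pos (mul_pos h1 h2)]
  congr 2
  linear_combination (x - y) * hdet

theorem IsPositiveMobius.exists_distortion {φ : ℝ → ℝ} (hφ : IsPositiveMobius φ) :
    ∃ c : ℝ≥0, 0 < c ∧ ∀ x ∈ Set.Icc (1 / 2 : ℝ) 1, ∀ y ∈ Set.Icc (1 / 2 : ℝ) 1,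
      c * |x - y| ≤ |φ x - φ y| ∧ |φ x - φ y| ≤ 4 * c * |x - y| := by
  obtain ⟨p, q, r, t, hp, hq, hr, ht, hdet, h⟩ := hφ
  have hpos : 0 < 1 / (r + t) ^ 2 := by positivity
  -- The constant is the derivative at 1. For `x ≥ 1/2` the denominator `r * x + t` is at least half
  -- its value at 1, whence the factor 4.
  refine ⟨NNReal.mk (1 / (r + t) ^ 2) hpos.le, hpos, fun x hx y hy => ?_⟩
  have hx0 : 0 ≤ x := by linarith [hx.1]
  have hy0 : 0 ≤ y := by linarith [hy.1]
  rw [h x hx0, h y hy0, abs_div_sub_div_of_det_eq_one hr ht hdet hx0 hy0, NNReal.coe_mk]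
  have h1 : 0 < r * x + t := by positivity
  have h2 : 0 < r * y + t := by positivity
  have e1 : r * x + t ≤ r + t := by nlinarith [hx.2]
  have e2 : r * y + t ≤ r + t := by nlinarith [hy.2]
  have f1 : (r + t) / 2 ≤ r * x + t := by nlinarith [hx.1]
  have f2 : (r + t) / 2 ≤ r * y + t := by nlinarith [hy.1]
  have hab := abs_nonneg (x - y)
  constructor
  · rw [one_div_mul_eq_div, sq]
    gcongr
  · have : 4 * (1 / (r + t) ^ 2) * |x - y| = |x - y| / ((r + t) / 2 * ((r + t) / 2)) := by
      field_simp
      ring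
    rw [this]
    gcongr

/-! ### Contraction, separation and covering by return branches -/

theorem abs_returnBranch_sub_le (i : ℕ × ℕ) {x y : ℝ} (hx : 1 / 2 ≤ x) (hy : 1 / 2 ≤ y) :
    |returnBranch i x - returnBranch i y| ≤ 1 / 4 * |x - y| := by
  have hx0 : 0 ≤ x := by linarith
  have hy0 : 0 ≤ y := by linarith
  rw [returnBranch_eq_div i hx0, returnBranch_eq_div i hy0,
    abs_div_sub_div_of_det_eq_one (by positivity) (by positivity) (by ring) hx0 hy0, div_eq_inv_mul]
  have h : ∀ z : ℝ, 0 ≤ z → 2 ≤ (1 + i.2 * (i.1 + 2)) * z + (i.1 + 2 : ℝ) := by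
    intro z hz
    have : 0 ≤ (1 + i.2 * (i.1 + 2)) * z + (i.1 : ℝ) := by positivity
    linarith
  gcongr
  rw [inv_le_comm₀ (by nlinarith [h x hx0, h y hy0]) (by norm_num)]
  nlinarith [h x hx0, h y hy0]

theorem returnBranch_mem_Ioo (i : ℕ × ℕ) {y : ℝ} (hy : 0 < y) :
    returnBranch i y ∈ Set.Ioo (1 / 2 : ℝ) 1 := by
  rw [returnBranch_eq_div i hy.le]
  have h : 0 < (1 + i.2 * (i.1 + 2)) * y + (i.1 + 2 : ℝ) := by positivity
  have h' : 0 ≤ (i.2 * i.1 : ℝ) * y := by positivity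
  have h'' : (0 : ℝ) ≤ i.1 := by positivity
  have h3 : (0 : ℝ) ≤ i.2 * y := by positivity
  rw [Set.mem_Ioo, lt_div_iff₀ h, div_lt_one h]
  constructor <;> nlinarith

/-- The open interval matters: the images of 1/2 and 1 under neighbouring branches coincide. -/
theorem returnBranch_injective {i j : ℕ × ℕ} {x y : ℝ} (hx : x ∈ Set.Ioo (1 / 2 : ℝ) 1)
    (hy : y ∈ Set.Ioo (1 / 2 : ℝ) 1) (h : returnBranch i x = returnBranch j y) :
    i = j ∧ x = y := by
  have hx0 : 0 < x := by linarith [hx.1]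
  have hy0 : 0 < y := by linarith [hy.1]
  have hx' := iterate_renyiBranch_one_mem_Ico i.2 (y := x) ⟨hx0.le, hx.2⟩
  have hy' := iterate_renyiBranch_one_mem_Ico j.2 (y := y) ⟨hy0.le, hy.2⟩
  have h1 : (i.1 + 2 : ℕ) + (renyiBranch 1)^[i.2] x = (j.1 + 2 : ℕ) + (renyiBranch 1)^[j.2] y := by
    rw [← one_div_one_sub_renyiBranch, ← one_div_one_sub_renyiBranch]
    exact congrArg (fun z => 1 / (1 - z)) h
  have h2 : (renyiBranch 1)^[i.2] x = (renyiBranch 1)^[j.2] y := by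
    rw [← renyiMap_renyiBranch (i.1 + 2) hx', ← renyiMap_renyiBranch (j.1 + 2) hy']
    exact congrArg renyiMap h
  have hij : i.1 = j.1 := by
    rw [h2] at h1
    have : (i.1 + 2 : ℕ) = (j.1 + 2 : ℕ) := by exact_mod_cast add_right_cancel h1
    omega
  rw [iterate_renyiBranch_one _ hx0.le, iterate_renyiBranch_one _ hy0.le] at h2
  -- In the coordinate `x⁻¹`, which lies in `(1, 2)`, the branch `renyiBranch 1` is translation by
  -- 1, so the floor recovers `i.2`.
  have h3 : x⁻¹ + i.2 = y⁻¹ + j.2 := by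
    have := congrArg (·⁻¹) h2
    simp only [inv_div] at this
    field_simp at this ⊢
    linarith
  have fl : ∀ (k : ℕ) {z : ℝ}, z ∈ Set.Ioo (1 / 2 : ℝ) 1 → ⌊z⁻¹ + k⌋ = k + 1 := by
    intro k z hz
    have hz0 : 0 < z := by linarith [hz.1]
    have : ⌊z⁻¹⌋ = 1 := by
      rw [Int.floor_eq_iff]
      have a1 := (one_le_inv₀ hz0).2 hz.2.le
      have a2 : z⁻¹ < 2 := by rw [inv_lt_comm₀ hz0 two_pos]; linarith [hz.1]
      norm_num
      exact ⟨a1, a2⟩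
    rw [Int.floor_add_natCast, this, add_comm]
  have hk : i.2 = j.2 := by
    have := congrArg Int.floor h3
    rw [fl _ hx, fl _ hy] at this
    omega
  rw [hk] at h3
  exact ⟨Prod.ext hij hk, inv_injective (add_right_cancel h3)⟩

/-- Two floors read off the branch: that of `1 / (1 - x)`, then that of the inverse of its
fractional part `z`. Irrationality gives `z ≠ 0`, and passes to `y` so that the step can be
iterated. -/
theorem exists_returnBranch_eq {x : ℝ} (hx : x ∈ Set.Icc (1 / 2 : ℝ) 1) (hirr : Irrational x) :
    ∃ i : ℕ × ℕ, ∃ y ∈ Set.Icc (1 / 2 : ℝ) 1, Irrational y ∧ returnBranch i y = x := by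
  have hx1 : 0 < 1 - x := by
    have : x ≠ 1 := hirr.ne_one
    have := lt_of_le_of_ne hx.2 this
    linarith
  have hu2 : 2 ≤ (1 - x)⁻¹ := by rw [le_inv_comm₀ two_pos hx1]; linarith [hx.1]
  have huirr : Irrational (1 - x)⁻¹ := irrational_inv_iff.2 (by simpa using hirr.ratCast_sub 1)
  set u := (1 - x)⁻¹ with hu
  have hfl : 2 ≤ ⌊u⌋₊ := Nat.le_floor (by exact_mod_cast hu2)
  obtain ⟨a, ha⟩ := Nat.exists_eq_add_of_le' hfl
  have h1 := Nat.floor_le (a := u) (by linarith)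
  have h2 := Nat.lt_floor_add_one u
  rw [ha] at h1 h2
  set z := u - (a + 2 : ℕ) with hz
  have hzirr : Irrational z := huirr.sub_natCast _
  have hz0 : 0 < z := lt_of_le_of_ne (by linarith) (fun h => hzirr.ne_zero h.symm)
  have hz1 : z < 1 := by linarith
  have hvirr : Irrational z⁻¹ := irrational_inv_iff.2 hzirr
  have hv1 : 1 ≤ z⁻¹ := (one_le_inv₀ hz0).2 hz1.le
  obtain ⟨k, hk⟩ := Nat.exists_eq_add_of_le' (Nat.le_floor (n := 1) (by exact_mod_cast hv1))
  have g1 := Nat.floor_le (a := z⁻¹) (by linarith)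
  have g2 := Nat.lt_floor_add_one z⁻¹
  rw [hk] at g1 g2
  push_cast at g1 g2
  have hw : 0 < z⁻¹ - k := by linarith
  refine ⟨(a, k), (z⁻¹ - k)⁻¹, ⟨?_, ?_⟩, irrational_inv_iff.2 (hvirr.sub_natCast k), ?_⟩
  · rw [one_div, inv_le_inv₀ two_pos hw]; linarith
  · exact inv_le_one_of_one_le₀ (by linarith)
  · have e : (z⁻¹ - k)⁻¹ / (1 + k * (z⁻¹ - k)⁻¹) = z := by
      have h : ∀ d : ℝ, 0 < d → d⁻¹ / (1 + k * d⁻¹) = (d + k)⁻¹ := by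
        intro d hd
        field_simp
      rw [h _ hw, sub_add_cancel, inv_inv]
    rw [returnBranch, iterate_renyiBranch_one _ (inv_pos.2 hw).le, e, renyiBranch, hz]
    simp [hu]

/-! ### Words of return branches -/

/-- The composition of return branches along a word. -/
noncomputable def returnWord : List (ℕ × ℕ) → ℝ → ℝ
  | [] => id
  | i :: l => returnBranch i ∘ returnWord l

theorem isPositiveMobius_returnWord (l : List (ℕ × ℕ)) : IsPositiveMobius (returnWord l) := by
  induction l with
  | nil => exact isPositiveMobius_id
  | cons i l ih => exact (isPositiveMobius_returnBranch i).comp ih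

theorem returnWord_mem_Icc (l : List (ℕ × ℕ)) {x : ℝ} (hx : x ∈ Set.Icc (1 / 2 : ℝ) 1) :
    returnWord l x ∈ Set.Icc (1 / 2 : ℝ) 1 := by
  induction l with
  | nil => exact hx
  | cons i l ih => exact Set.Ioo_subset_Icc_self (returnBranch_mem_Ioo i (by linarith [ih.1]))

theorem returnWord_mem_Ioo_of_ne_nil {l : List (ℕ × ℕ)} (hl : l ≠ []) {x : ℝ}
    (hx : x ∈ Set.Icc (1 / 2 : ℝ) 1) : returnWord l x ∈ Set.Ioo (1 / 2 : ℝ) 1 := by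
  cases l with
  | nil => exact absurd rfl hl
  | cons i l => exact returnBranch_mem_Ioo i (by linarith [(returnWord_mem_Icc l hx).1])

theorem returnWord_mem_Ioo (l : List (ℕ × ℕ)) {x : ℝ} (hx : x ∈ Set.Ioo (1 / 2 : ℝ) 1) :
    returnWord l x ∈ Set.Ioo (1 / 2 : ℝ) 1 := by
  rcases eq_or_ne l [] with rfl | hl
  · exact hx
  · exact returnWord_mem_Ioo_of_ne_nil hl (Set.Ioo_subset_Icc_self hx)

theorem abs_returnWord_sub_le (l : List (ℕ × ℕ)) {x y : ℝ} (hx : x ∈ Set.Icc (1 / 2 : ℝ) 1)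
    (hy : y ∈ Set.Icc (1 / 2 : ℝ) 1) :
    |returnWord l x - returnWord l y| ≤ (1 / 4) ^ l.length * |x - y| := by
  induction l with
  | nil => simp [returnWord]
  | cons i l ih =>
    refine (abs_returnBranch_sub_le i (returnWord_mem_Icc l hx).1
      (returnWord_mem_Icc l hy).1).trans ?_
    rw [List.length_cons, pow_succ', mul_assoc]
    gcongr

theorem returnWord_injective {l l' : List (ℕ × ℕ)} (hlen : l.length = l'.length) {x y : ℝ}
    (hx : x ∈ Set.Ioo (1 / 2 : ℝ) 1) (hy : y ∈ Set.Ioo (1 / 2 : ℝ) 1)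
    (h : returnWord l x = returnWord l' y) : l = l' := by
  induction l generalizing l' with
  | nil => exact (List.length_eq_zero_iff.1 hlen.symm).symm
  | cons i l ih =>
    cases l' with
    | nil => simp at hlen
    | cons j l' =>
      obtain ⟨rfl, h'⟩ := returnBranch_injective (returnWord_mem_Ioo l hx)
        (returnWord_mem_Ioo l' hy) h
      rw [ih (by simpa using hlen) h']

theorem exists_returnWord_eq (m : ℕ) {x : ℝ} (hx : x ∈ Set.Icc (1 / 2 : ℝ) 1)
    (hirr : Irrational x) :
    ∃ l : List (ℕ × ℕ), l.length = m ∧ ∃ y ∈ Set.Icc (1 / 2 : ℝ) 1, returnWord l y = x := by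
  induction m generalizing x with
  | zero => exact ⟨[], rfl, x, hx, rfl⟩
  | succ m ih =>
    obtain ⟨i, y, hy, hyirr, rfl⟩ := exists_returnBranch_eq hx hirr
    obtain ⟨l, rfl, z, hz, rfl⟩ := ih hy hyirr
    exact ⟨i :: l, rfl, z, hz, rfl⟩

/-- A gain of one digit per word is all that the induction over prefixes needs. -/
theorem returnWord_mem_bcfPrefixBoundedBy {n m : ℕ} {l : List (ℕ × ℕ)} (hl : l ≠ [])
    (hn : ∀ i ∈ l, i.1 + 2 < n) {y : ℝ} (hy : y ∈ bcfPrefixBoundedBy n m) :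
    returnWord l y ∈ bcfPrefixBoundedBy n (m + 1) := by
  have weak : ∀ l : List (ℕ × ℕ), (∀ i ∈ l, i.1 + 2 < n) →
      returnWord l y ∈ bcfPrefixBoundedBy n m := by
    intro l hl
    induction l with
    | nil => exact hy
    | cons i l ih =>
      exact bcfPrefixBoundedBy_succ_subset _ _ (returnBranch_mem_bcfPrefixBoundedBy
        (hl i (by simp)) (ih fun j hj => hl j (by simp [hj])))
  cases l with
  | nil => exact absurd rfl hl
  | cons i l =>
    exact returnBranch_mem_bcfPrefixBoundedBy (hn i (by simp))
      (weak l fun j hj => hn j (by simp [hj]))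

/-! ### Contraction ratios and their sums -/

/-- A lower bound for the contraction of a word on `[1/2, 1]`, sharp up to a factor `4`. -/
noncomputable def wordRatio (l : List (ℕ × ℕ)) : ℝ≥0 :=
  (isPositiveMobius_returnWord l).exists_distortion.choose

theorem wordRatio_pos (l : List (ℕ × ℕ)) : 0 < wordRatio l :=
  (isPositiveMobius_returnWord l).exists_distortion.choose_spec.1

theorem wordRatio_mul_le (l : List (ℕ × ℕ)) {x y : ℝ} (hx : x ∈ Set.Icc (1 / 2 : ℝ) 1)
    (hy : y ∈ Set.Icc (1 / 2 : ℝ) 1) :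
    wordRatio l * |x - y| ≤ |returnWord l x - returnWord l y| :=
  ((isPositiveMobius_returnWord l).exists_distortion.choose_spec.2 x hx y hy).1

theorem abs_returnWord_sub_le_wordRatio (l : List (ℕ × ℕ)) {x y : ℝ}
    (hx : x ∈ Set.Icc (1 / 2 : ℝ) 1) (hy : y ∈ Set.Icc (1 / 2 : ℝ) 1) :
    |returnWord l x - returnWord l y| ≤ 4 * wordRatio l * |x - y| :=
  ((isPositiveMobius_returnWord l).exists_distortion.choose_spec.2 x hx y hy).2

theorem wordRatio_le (l : List (ℕ × ℕ)) : wordRatio l ≤ (1 / 4) ^ l.length := by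
  have h1 : (1 : ℝ) ∈ Set.Icc (1 / 2 : ℝ) 1 := by norm_num
  have h2 : (1 / 2 : ℝ) ∈ Set.Icc (1 / 2 : ℝ) 1 := by norm_num
  have h := (wordRatio_mul_le l h1 h2).trans (abs_returnWord_sub_le l h1 h2)
  have h' := le_of_mul_le_mul_right h (by norm_num)
  exact_mod_cast h'

theorem continuousOn_returnWord (l : List (ℕ × ℕ)) :
    ContinuousOn (returnWord l) (Set.Icc (1 / 2 : ℝ) 1) := by
  have : LipschitzOnWith (4 * wordRatio l) (returnWord l) (Set.Icc (1 / 2 : ℝ) 1) :=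
    LipschitzOnWith.of_dist_le_mul fun x hx y hy => by
      simpa [Real.dist_eq] using abs_returnWord_sub_le_wordRatio l hx hy
  exact this.continuousOn

theorem volume_image_returnWord_le (l : List (ℕ × ℕ)) :
    MeasureTheory.volume (returnWord l '' Set.Icc (1 / 2 : ℝ) 1) ≤ 2 * wordRatio l := by
  refine (Real.volume_le_diam _).trans (Metric.ediam_le ?_)
  rintro _ ⟨x, hx, rfl⟩ _ ⟨y, hy, rfl⟩
  have h := abs_returnWord_sub_le_wordRatio l hx hy
  have h' : |x - y| ≤ 1 / 2 := by
    rw [abs_le]; constructor <;> linarith [hx.1, hx.2, hy.1, hy.2]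
  rw [edist_dist, Real.dist_eq]
  refine ENNReal.ofReal_le_of_le_toReal ?_
  simp only [ENNReal.toReal_mul, ENNReal.toReal_ofNat, ENNReal.coe_toReal]
  nlinarith [(wordRatio l).2]

/-- Lebesgue measure: the images cover `[1/2, 1]` up to the rationals, and each has measure at most
twice its ratio. -/
theorem one_fourth_le_tsum_wordRatio (m : ℕ) :
    (1 / 4 : ℝ≥0∞) ≤ ∑' l : {l : List (ℕ × ℕ) // l.length = m}, (wordRatio l : ℝ≥0∞) := by
  have hcov : Set.Icc (1 / 2 : ℝ) 1 \ Set.range ((↑) : ℚ → ℝ) ⊆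
      ⋃ l : {l : List (ℕ × ℕ) // l.length = m}, returnWord l '' Set.Icc (1 / 2 : ℝ) 1 := by
    rintro x ⟨hx, hirr⟩
    obtain ⟨l, hl, y, hy, hxy⟩ := exists_returnWord_eq m hx hirr
    exact Set.mem_iUnion.2 ⟨⟨l, hl⟩, y, hy, hxy⟩
  have hvol : (1 / 2 : ℝ≥0∞) ≤
      2 * ∑' l : {l : List (ℕ × ℕ) // l.length = m}, (wordRatio l : ℝ≥0∞) := by
    calc (1 / 2 : ℝ≥0∞) = MeasureTheory.volume (Set.Icc (1 / 2 : ℝ) 1) := by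
          rw [Real.volume_Icc, show (1 : ℝ) - 1 / 2 = 2⁻¹ by norm_num,
            ENNReal.ofReal_inv_of_pos two_pos]
          simp
      _ = MeasureTheory.volume (Set.Icc (1 / 2 : ℝ) 1 \ Set.range ((↑) : ℚ → ℝ)) :=
          (MeasureTheory.measure_sdiff_null ((Set.countable_range _).measure_zero _)).symm
      _ ≤ _ := MeasureTheory.measure_mono hcov
      _ ≤ _ := MeasureTheory.measure_iUnion_le _
      _ ≤ ∑' l : {l : List (ℕ × ℕ) // l.length = m}, 2 * (wordRatio l : ℝ≥0∞) :=
          ENNReal.tsum_le_tsum fun l => volume_image_returnWord_le l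
      _ = _ := ENNReal.tsum_mul_left
  calc (1 / 4 : ℝ≥0∞) = 2⁻¹ * (1 / 2) := by
        rw [one_div, one_div, ← ENNReal.mul_inv (by simp) (by simp)]; norm_num
    _ ≤ 2⁻¹ * (2 * ∑' l : {l : List (ℕ × ℕ) // l.length = m}, (wordRatio l : ℝ≥0∞)) := by gcongr
    _ = _ := by rw [← mul_assoc, ENNReal.inv_mul_cancel (by simp) (by simp), one_mul]

theorem exists_one_le_sum_wordRatio_rpow {s : ℝ} (hs1 : s < 1) :
    ∃ m : ℕ, m ≠ 0 ∧ ∃ W : Finset (List (ℕ × ℕ)), (∀ l ∈ W, l.length = m) ∧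
      1 ≤ ∑ l ∈ W, (wordRatio l : ℝ≥0∞) ^ s := by
  classical
  -- This makes `4 ^ (m * (1 - s)) > 4`, which beats the constant 1/4.
  obtain ⟨m, hm⟩ : ∃ m : ℕ, 1 < m * (1 - s) := by
    obtain ⟨m, hm⟩ := exists_nat_gt (1 / (1 - s))
    exact ⟨m, by rwa [div_lt_iff₀ (by linarith)] at hm⟩
  have hm0 : m ≠ 0 := by rintro rfl; norm_num at hm
  have hterm : ∀ l : {l : List (ℕ × ℕ) // l.length = m},
      ENNReal.ofReal (4 ^ (m * (1 - s))) * (wordRatio l : ℝ≥0∞) ≤ (wordRatio l : ℝ≥0∞) ^ s := by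
    rintro ⟨l, rfl⟩
    have h0 : (0 : ℝ) < wordRatio l := wordRatio_pos l
    have h1 : (wordRatio l : ℝ) ≤ (1 / 4) ^ l.length := by exact_mod_cast wordRatio_le l
    have key : (4 : ℝ) ^ (l.length * (1 - s)) * wordRatio l ≤ (wordRatio l : ℝ) ^ s := by
      have e : (wordRatio l : ℝ) = (wordRatio l : ℝ) ^ s * (wordRatio l : ℝ) ^ (1 - s) := by
        rw [← Real.rpow_add h0]; simp
      have h2 : (wordRatio l : ℝ) ^ (1 - s) ≤ ((4 : ℝ) ^ (l.length * (1 - s)))⁻¹ := by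
        refine (Real.rpow_le_rpow h0.le h1 (by linarith)).trans_eq ?_
        rw [one_div, inv_pow, Real.inv_rpow (by positivity), ← Real.rpow_natCast,
          ← Real.rpow_mul (by norm_num)]
      have h4 : (0 : ℝ) < 4 ^ (l.length * (1 - s)) := by positivity
      calc (4 : ℝ) ^ (l.length * (1 - s)) * wordRatio l
          = (wordRatio l : ℝ) ^ s * ((4 : ℝ) ^ (l.length * (1 - s)) *
            (wordRatio l : ℝ) ^ (1 - s)) := by
            nth_rewrite 1 [e]; ring
        _ ≤ (wordRatio l : ℝ) ^ s * ((4 : ℝ) ^ (l.length * (1 - s)) *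
            ((4 : ℝ) ^ (l.length * (1 - s)))⁻¹) := by gcongr
        _ = _ := by rw [mul_inv_cancel₀ h4.ne', mul_one]
    have h := ENNReal.ofReal_le_ofReal key
    rwa [ENNReal.ofReal_mul (by positivity), ← ENNReal.ofReal_rpow_of_pos h0,
      ENNReal.ofReal_coe_nnreal] at h
  have hbig : (4 : ℝ) < 4 ^ (m * (1 - s)) := by
    simpa using Real.rpow_lt_rpow_of_exponent_lt (x := 4) (by norm_num) hm
  have hlt : 1 < ∑' l : {l : List (ℕ × ℕ) // l.length = m}, (wordRatio l : ℝ≥0∞) ^ s := by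
    calc (1 : ℝ≥0∞) = 4 * (1 / 4) := by
          rw [one_div, ENNReal.mul_inv_cancel (by simp) (by simp)]
      _ < ENNReal.ofReal (4 ^ (m * (1 - s))) * (1 / 4) := by
          rw [ENNReal.mul_lt_mul_iff_left (by simp) (by simp)]
          rw [ENNReal.lt_ofReal_iff_toReal_lt (by simp)]
          simpa using hbig
      _ ≤ ENNReal.ofReal (4 ^ (m * (1 - s))) *
          ∑' l : {l : List (ℕ × ℕ) // l.length = m}, (wordRatio l : ℝ≥0∞) := by
          gcongr
          exact one_fourth_le_tsum_wordRatio m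
      _ = _ := ENNReal.tsum_mul_left.symm
      _ ≤ _ := ENNReal.tsum_le_tsum hterm
  rw [ENNReal.tsum_eq_iSup_sum, lt_iSup_iff] at hlt
  obtain ⟨W, hW⟩ := hlt
  refine ⟨m, hm0, W.map ⟨Subtype.val, Subtype.val_injective⟩, ?_, ?_⟩
  · intro l hl
    obtain ⟨l', -, rfl⟩ := Finset.mem_map.1 hl
    exact l'.2
  · rw [Finset.sum_map]
    exact hW.le

/-! ### Dimension of the bounded-digit sets -/

theorem exists_le_dimH_bcfBoundedBy {s : ℝ≥0} (hs0 : 0 < s) (hs1 : s < 1) :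
    ∃ n : ℕ, (s : ℝ≥0∞) ≤ dimH (bcfBoundedBy n) := by
  classical
  obtain ⟨m, hm, W, hlen, hsum⟩ := exists_one_le_sum_wordRatio_rpow (s := s) (by exact_mod_cast hs1)
  have hnil : ∀ l ∈ W, l ≠ [] := by
    rintro l hl rfl
    exact hm (hlen _ hl).symm
  obtain ⟨n, hn⟩ : ∃ n : ℕ, ∀ l ∈ W, ∀ i ∈ l, i.1 + 2 < n := by
    refine ⟨(W.sup fun l => (l.map fun i => i.1).sum) + 3, fun l hl i hi => ?_⟩
    have h1 : i.1 ≤ (l.map fun i => i.1).sum :=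
      List.single_le_sum (by simp) _ (List.mem_map_of_mem hi)
    have h2 := Finset.le_sup (f := fun l : List (ℕ × ℕ) => (l.map fun i => i.1).sum) hl
    omega
  set J := Set.Icc (1 / 2 : ℝ) 1 with hJ
  set E := maximalSelfCover J W returnWord with hE
  have hEJ : E ⊆ J := maximalSelfCover_subset
  have hmaps : ∀ l ∈ W, Set.MapsTo (returnWord l) J J := fun l _ x hx => returnWord_mem_Icc l hx
  have hcov : ∀ x ∈ E, ∃ l ∈ W, ∃ y ∈ E, returnWord l y = x := fun x hx => by
    obtain ⟨l, hl, y, hy, hxy⟩ := Set.mem_iUnion₂.1 (maximalSelfCover_subset_iUnion_image hx)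
    exact ⟨l, hl, y, hy, hxy⟩
  -- Excluding the endpoints is what makes the copies of `E` disjoint.
  have hEI : E ⊆ Set.Ioo (1 / 2 : ℝ) 1 := by
    intro x hx
    obtain ⟨l, hl, y, hy, rfl⟩ := hcov x hx
    exact returnWord_mem_Ioo_of_ne_nil (hnil l hl) (hEJ hy)
  have hEn : E ⊆ bcfBoundedBy n := by
    have : ∀ m, E ⊆ bcfPrefixBoundedBy n m := by
      intro m
      induction m with
      | zero =>
        exact fun x hx => ⟨⟨by linarith [(hEI hx).1], (hEI hx).2⟩, fun j hj => by simp at hj⟩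
      | succ m ih =>
        intro x hx
        obtain ⟨l, hl, y, hy, rfl⟩ := hcov x hx
        exact returnWord_mem_bcfPrefixBoundedBy (hnil l hl) (hn l hl) (ih hy)
    exact fun x hx => mem_bcfBoundedBy_of_forall_prefix fun m => this m hx
  -- A fixed point of one word, given by the intermediate value theorem, is a self-covered
  -- singleton.
  have hne : E.Nonempty := by
    obtain ⟨l, hl⟩ : W.Nonempty := by
      rw [Finset.nonempty_iff_ne_empty]
      rintro rfl
      simp at hsum
    obtain ⟨x, hx, hfix⟩ := exists_mem_Icc_isFixedPt_of_mapsTo (continuousOn_returnWord l)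
      (by norm_num) (hmaps l hl)
    exact ⟨x, subset_maximalSelfCover (A := {x}) (Set.singleton_subset_iff.2 hx)
      (by
        rw [Set.singleton_subset_iff]
        exact Set.mem_iUnion₂.2 ⟨l, hl, x, rfl, hfix⟩) rfl⟩
  refine ⟨n, le_trans ?_ (dimH_mono hEn)⟩
  refine le_dimH_of_sum_rpow_ge_one (isCompact_maximalSelfCover isCompact_Icc
    fun l _ => continuousOn_returnWord l) hne W returnWord wordRatio hs0
    (fun l _ => wordRatio_pos l) (fun l hl => ?_) hsum
    (fun l _ => (continuousOn_returnWord l).mono hEJ)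
    (fun l hl x hx => mapsTo_maximalSelfCover hmaps hl hx) (fun l _ x hx y hy => ?_)
    (fun l hl l' hl' hll' => ?_)
  · refine (wordRatio_le l).trans_lt (pow_lt_one₀ (by simp) ?_ (hlen l hl ▸ hm))
    rw [one_div]
    exact inv_lt_one_of_one_lt₀ (by norm_num)
  · have h := ENNReal.ofReal_le_ofReal (wordRatio_mul_le l (hEJ hx) (hEJ hy))
    rwa [ENNReal.ofReal_mul (by positivity), ENNReal.ofReal_coe_nnreal, ← Real.dist_eq,
      ← Real.dist_eq, ← edist_dist, ← edist_dist] at h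
  · rw [Set.disjoint_left]
    rintro _ ⟨x, hx, rfl⟩ ⟨y, hy, hxy⟩
    exact hll' (returnWord_injective ((hlen l hl).trans (hlen l' hl').symm) (hEI hx) (hEI hy)
      hxy.symm)

theorem bcfBoundedBy_mono : Monotone bcfBoundedBy := fun _ _ hmn _ hx =>
  ⟨hx.1, fun j hj => (hx.2 j hj).trans (by exact_mod_cast hmn)⟩

theorem dimH_le_one (A : Set ℝ) : dimH A ≤ 1 :=
  (dimH_mono (Set.subset_univ A)).trans_eq Real.dimH_univ

/-- Only rationals are lost, and a countable set has dimension 0. -/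
theorem dimH_bcfBoundedBy_le_dimH_bcfBounded (n : ℕ) : dimH (bcfBoundedBy n) ≤ dimH bcfBounded := by
  have h : bcfBoundedBy n ⊆ bcfBounded ∪ Set.range ((↑) : ℚ → ℝ) := by
    intro x hx
    by_cases hirr : Irrational x
    · exact Or.inl ⟨⟨lt_of_le_of_ne hx.1.1 hirr.ne_zero.symm, hx.1.2⟩, hirr, n, hx.2⟩
    · exact Or.inr (not_not.1 hirr)
  refine (dimH_mono h).trans ?_
  rw [dimH_union, dimH_countable (Set.countable_range _)]
  simp

theorem iSup_dimH_bcfBoundedBy : ⨆ n, dimH (bcfBoundedBy n) = 1 := by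
  refine le_antisymm (iSup_le fun n => dimH_le_one _) (le_of_forall_lt fun r hr => ?_)
  obtain ⟨s, hrs, hs1⟩ := ENNReal.lt_iff_exists_nnreal_btwn.1 hr
  have hs0 : 0 < s := by exact_mod_cast zero_le.trans_lt hrs
  obtain ⟨n, hn⟩ := exists_le_dimH_bcfBoundedBy hs0 (by exact_mod_cast hs1)
  exact hrs.trans_le (hn.trans (le_iSup (fun n => dimH (bcfBoundedBy n)) n))

theorem proposition1p3 :
    Tendsto (fun n : ℕ => dimH (bcfBoundedBy n)) atTop (𝓝 1) ∧ dimH bcfBounded = 1 := by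
  constructor
  · rw [← iSup_dimH_bcfBoundedBy]
    exact tendsto_atTop_iSup fun m n h => dimH_mono (bcfBoundedBy_mono h)
  · refine le_antisymm (dimH_le_one _) ?_
    rw [← iSup_dimH_bcfBoundedBy]
    exact iSup_le dimH_bcfBoundedBy_le_dimH_bcfBounded
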